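/- Let $t\ge 2$ and let $q$ be a probability mass function on $\mathcal X^t$, with $\mathcal X$ a finite set, such that $(X_1,\dots,X_t)\sim q$ satisfies $X_1=\dots=X_t=X$ almost surely; let $H(X)$ be the Shannon entropy of $X$ in bits. In the individually shared randomness model with an omniscient coordinator there are independent random variables $W_1,\dots,W_t$, with $W_i$ uniform on $[1:2^{nR_i}]$ (here $[1:a]=\{1,\dots,\lfloor a\rfloor\}$). A coordinator observes all of $W_1,\dots,W_t$ and sends a message $M\in[1:2^{nR}]$, drawn from a conditional p.m.f. $p(m\mid w_1,\dots,w_t)$, to all $t$ processors; processor $i$ observes only $(M,W_i)$ and outputs $X_i^n\in\mathcal X^n$ drawn from a conditional p.m.f. $p(x_i^n\mid m,w_i)$, so that the induced output distribution is $$p(x_1^n,\dots,x_t^n)=\sum_{w_1,\dots,w_t}\sum_m \Big(\prod_{i=1}^t\frac1{\lfloor 2^{nR_i}\rfloor}\Big)\,p(m\mid w_1,\dots,w_t)\prod_{i=1}^t p(x_i^n\mid m,w_i).$$ A tuple $(R,R_1,\dots,R_t)$ of non-negative reals is achievable for $q$ if there is a sequence, over $n$, of such codes with $\lim_{n\to\infty}\big\|p_{X_1^n,\dots,X_t^n}-q^{(n)}\big\|_1=0$,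 where $q^{(n)}(x_1^n,\dots,x_t^n)=\prod_{k=1}^n q(x_{1k},\dots,x_{tk})$. The simulation rate region $\mathcal R^{\mathrm{Indv}}$ is the closure of the set of achievable tuples. Theorem. $\mathcal R^{\mathrm{Indv}}$ is exactly the set of all non-negative tuples $(R,R_1,\dots,R_t)$ such that $$R+\min\{R_1,\dots,R_t\}\ \ge\ H(X)\qquad\text{and}\qquad R\ \ge\ \frac{(t-1)H(X)}{t}.$$ -/

import Mathlib

open scoped BigOperators

/-- The number of elements of `[1 : 2^{nR}]`, i.e. of integers `m` with `1 ≤ m ≤ 2^{nR}`. -/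
noncomputable def indexSize (n : ℕ) (R : ℝ) : ℕ := ⌊(2 : ℝ) ^ ((n : ℝ) * R)⌋₊

/-- A simulation code of block length `n` for `t` processors and `h` sources of randomness, where
processor `i` has access to the sources with index in `V i`, the message takes `K` values and the
`j`-th source takes `L j` values. It consists of the random map of the coordinator (which sees all
the sources) and the random maps of the processors (processor `i` sees the message and the sources
in `V i`). -/
structure SimulationCode {t h : ℕ} (V : Fin t → Finset (Fin h)) (A : Fin t → Type*)
    (n K : ℕ) (L : Fin h → ℕ) where
  coordinator : (∀ j : Fin h, Fin (L j)) → PMF (Fin K)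
  processor : ∀ i : Fin t, Fin K → (∀ j : V i, Fin (L j)) → PMF (Fin n → A i)

/-- The distribution of `(X₁ⁿ, …, X_tⁿ)` induced by a simulation code, when the sources are
independent and the `j`-th one is uniform on its `L j` values. -/
noncomputable def SimulationCode.induced {t h : ℕ} {V : Fin t → Finset (Fin h)}
    {A : Fin t → Type*} {n K : ℕ} {L : Fin h → ℕ} (c : SimulationCode V A n K L)
    (x : ∀ i : Fin t, Fin n → A i) : ℝ :=
  ∑ w : (∀ j : Fin h, Fin (L j)), ∑ m : Fin K,
    (c.coordinator w m).toReal *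
      (∏ i : Fin t, (c.processor i m (fun j => w j) (x i)).toReal) / ∏ j : Fin h, (L j : ℝ)

/-- The `n`-fold i.i.d. extension of the joint p.m.f. `q`. -/
noncomputable def iidLaw {t : ℕ} {A : Fin t → Type*} (q : PMF (∀ i, A i)) (n : ℕ)
    (x : ∀ i : Fin t, Fin n → A i) : ℝ :=
  ∏ k : Fin n, (q (fun i => x i k)).toReal

/-- The rate tuple `(R, R₁, …, R_h)` is achievable for the p.m.f. `q`: there is a sequence of
`(n, 2^{nR}, 2^{nR₁}, …, 2^{nR_h})` simulation codes whose induced distribution approaches the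
i.i.d. one in total variation. Rates are non-negative. -/
def IsAchievable {t h : ℕ} (V : Fin t → Finset (Fin h)) {A : Fin t → Type*}
    [∀ i, Fintype (A i)] (q : PMF (∀ i, A i)) (R : ℝ) (Rs : Fin h → ℝ) : Prop :=
  0 ≤ R ∧ (∀ j, 0 ≤ Rs j) ∧
    ∃ c : ∀ n : ℕ, SimulationCode V A n (indexSize n R) (fun j => indexSize n (Rs j)),
      Filter.Tendsto
        (fun n : ℕ => ∑ x : (∀ i : Fin t, Fin n → A i), |(c n).induced x - iidLaw q n x|)
        Filter.atTop (nhds 0)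

/-- The simulation rate region: the closure of the set of achievable rate tuples
`(R, (R₁, …, R_h))`. -/
def simulationRegion {t h : ℕ} (V : Fin t → Finset (Fin h)) {A : Fin t → Type*}
    [∀ i, Fintype (A i)] (q : PMF (∀ i, A i)) : Set (ℝ × (Fin h → ℝ)) :=
  closure {r : ℝ × (Fin h → ℝ) | IsAchievable V q r.1 r.2}

/-- The individually shared randomness model: `h = t` and processor `i` has access exactly to the
`i`-th source. -/
def individualAccess (t : ℕ) : Fin t → Finset (Fin t) := fun i => {i}

/-- The Shannon entropy, in bits, of a p.m.f. on a finite set. -/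
noncomputable def entropyBits {α : Type*} [Fintype α] (p : PMF α) : ℝ :=
  -∑ a : α, (p a).toReal * Real.logb 2 (p a).toReal

/-!
Let `P` be the `n`-fold product of the law of `X`. The mass `∑ min (P y) (2 ^ (-n c))` tends to `1`
when `c < H(X)` and to `0` when `c > H(X)`: both follow from a Chernoff bound on
`E[(p(X) 2 ^ c) ^ s]`, whose derivative at `s = 0` has the sign of `c - H(X)`.

For the converse, a code that simulates `P` on the diagonal must therefore carry almost all its mass
after capping at `b = 2 ^ (-n c)`, for every `c < H(X)`. Given the message, the outputs are nearly
independent: bounding the law of `(y, …, y)` by a sum over messages of a product of `t` laws and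
using the geometric–arithmetic mean inequality limits the capped mass to
`2 ^ (n R) b ^ (1 - 1 / t)`. Splitting instead over the observation `(M, W_i)` of one
processor, of which there are `2 ^ (n (R + R_i))` values, and using the Cauchy–Schwarz inequality
limits it to `√(2 ^ (n (R + R_i)) b)`.

For achievability, the coordinator extracts from every source a uniform element `g_j` of a group of
order `2 ^ (n a)` and reveals the differences of the `g_j`, at rate `(t - 1) a`, along with fresh
randomness of rate `b = R - (t - 1) a`. Each processor recovers all of `g_1, …, g_t` from its own
`g_i`, so that common randomness of rate `t a + b = R + a` is available for generating `X ^ n`.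
Taking `a = min (R_1, …, R_t, H(X) / t)`, with a little slack in the rates, covers the region.
-/

open Filter Topology
open scoped Finset

section Inequalities

theorem min_le_rpow_mul_rpow {a b s : ℝ} (ha : 0 ≤ a) (hb : 0 ≤ b) (hs0 : 0 ≤ s) (hs1 : s ≤ 1) :
    min a b ≤ a ^ (1 - s) * b ^ s := by
  have h0 : 0 ≤ min a b := le_min ha hb
  calc min a b = min a b ^ (1 - s) * min a b ^ s := by
        rw [← Real.rpow_add_of_nonneg h0 (by linarith) hs0, sub_add_cancel, Real.rpow_one]
    _ ≤ a ^ (1 - s) * b ^ s := by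
        gcongr
        · exact min_le_left a b
        · exact min_le_right a b

theorem sub_min_le_rpow_mul_rpow_neg {a b s : ℝ} (ha : 0 ≤ a) (hb : 0 < b) (hs : 0 ≤ s) :
    a - min a b ≤ a ^ (1 + s) * b ^ (-s) := by
  rcases le_total a b with hab | hba
  · rw [min_eq_left hab, sub_self]
    positivity
  · have h1 : 1 ≤ (a / b) ^ s := Real.one_le_rpow ((one_le_div hb).2 hba) hs
    calc a - min a b ≤ a := sub_le_self a (le_min ha hb.le)
      _ ≤ a * (a / b) ^ s := le_mul_of_one_le_right ha h1
      _ = a ^ (1 + s) * b ^ (-s) := by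
        rw [Real.rpow_add (hb.trans_le hba), Real.rpow_one, Real.rpow_neg hb.le,
          Real.div_rpow ha hb.le, div_eq_mul_inv, mul_assoc]

theorem min_sum_le_sum_min {ι : Type*} (s : Finset ι) {f : ι → ℝ} {b : ℝ} (hb : 0 ≤ b)
    (hf : ∀ i ∈ s, 0 ≤ f i) : min (∑ i ∈ s, f i) b ≤ ∑ i ∈ s, min (f i) b := by
  by_cases h : ∃ i ∈ s, b ≤ f i
  · obtain ⟨i, hi, hbi⟩ := h
    calc min (∑ i ∈ s, f i) b ≤ min (f i) b := by rw [min_eq_right hbi]; exact min_le_right _ _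
      _ ≤ ∑ i ∈ s, min (f i) b :=
        Finset.single_le_sum (f := fun i => min (f i) b) (fun j hj => le_min (hf j hj) hb) hi
  · push Not at h
    exact (min_le_left _ _).trans_eq
      (Finset.sum_congr rfl fun i hi => (min_eq_left (h i hi).le).symm)

theorem sum_comp_le_sum_of_injective {ι κ : Type*} [Fintype ι] [Fintype κ] {e : ι → κ}
    (he : Function.Injective e) {f : κ → ℝ} (hf : ∀ k, 0 ≤ f k) : ∑ i, f (e i) ≤ ∑ k, f k :=
  (Finset.sum_map Finset.univ ⟨e, he⟩ f).symm.trans_le (Finset.sum_le_univ_sum_of_nonneg hf)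

theorem sum_abs_sub_eq_two_mul_sum_posPart {ι : Type*} (s : Finset ι) {f g : ι → ℝ}
    (h : ∑ i ∈ s, f i = ∑ i ∈ s, g i) :
    ∑ i ∈ s, |f i - g i| = 2 * ∑ i ∈ s, (g i - f i)⁺ := by
  have habs (i : ι) : |f i - g i| = (f i - g i) + 2 * (g i - f i)⁺ := by
    rw [← neg_sub, abs_neg, ← posPart_add_negPart (g i - f i)]
    linarith [posPart_sub_negPart (g i - f i)]
  simp only [habs, Finset.sum_add_distrib, Finset.sum_sub_distrib, h, sub_self, zero_add,
    Finset.mul_sum]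

theorem sum_posPart_sub_le_of_mul_sub_le {ι : Type*} (s : Finset ι) {f g : ι → ℝ} {θ d : ℝ}
    (hf : ∀ i ∈ s, 0 ≤ f i) (hf1 : ∑ i ∈ s, f i = 1) (hg : ∀ i ∈ s, 0 ≤ g i) (hd : 0 ≤ d)
    (hθ1 : θ ≤ 1) (h : ∀ i ∈ s, θ * (f i - d) ≤ g i) :
    ∑ i ∈ s, (f i - g i)⁺ ≤ (1 - θ) + ∑ i ∈ s, min (f i) d := by
  have hsplit : 1 - θ = ∑ i ∈ s, (1 - θ) * f i := by rw [← Finset.mul_sum, hf1, mul_one]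
  rw [hsplit, ← Finset.sum_add_distrib]
  refine Finset.sum_le_sum fun i hi => ?_
  have hslack : 0 ≤ (1 - θ) * f i := mul_nonneg (sub_nonneg.2 hθ1) (hf i hi)
  refine sup_le ?_ (add_nonneg hslack (le_min (hf i hi) hd))
  rcases le_total (f i) d with hfd | hdf
  · rw [min_eq_left hfd]
    linarith [hg i hi]
  · rw [min_eq_right hdf]
    linarith [h i hi, mul_le_of_le_one_left hd hθ1]

theorem sum_min_sum_prod_le {M ι Y : Type*} [Fintype M] [Fintype ι] [Nonempty ι] [Fintype Y]
    {f : M → ι → Y → ℝ} (hf : ∀ m i y, 0 ≤ f m i y) (hf1 : ∀ m i, ∑ y, f m i y = 1)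
    {b : ℝ} (hb : 0 ≤ b) :
    ∑ y, min (∑ m, ∏ i, f m i y) b ≤
      Fintype.card M * b ^ (1 - (Fintype.card ι : ℝ)⁻¹) := by
  set k := (Fintype.card ι : ℝ)
  have hk : 1 ≤ k := Nat.one_le_cast.2 Fintype.card_pos
  have hprod (m : M) (y : Y) : 0 ≤ ∏ i, f m i y := Finset.prod_nonneg fun i _ => hf m i y
  have hmean (m : M) (y : Y) : (∏ i, f m i y) ^ k⁻¹ ≤ (∑ i, f m i y) / k := by
    simpa using Real.geom_mean_le_arith_mean Finset.univ (fun _ => 1) (f m · y)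
      (fun _ _ => zero_le_one) (by simp [Fintype.card_pos]) (fun i _ => hf m i y)
  have hsum (m : M) : ∑ y, (∑ i, f m i y) / k = 1 := by
    rw [← Finset.sum_div, Finset.sum_comm]
    simp only [hf1, Finset.sum_const, Finset.card_univ, nsmul_eq_mul, mul_one]
    exact div_self (by linarith)
  calc ∑ y, min (∑ m, ∏ i, f m i y) b
      ≤ ∑ y, ∑ m, min b (∏ i, f m i y) := by
        simp only [min_comm b]
        exact Finset.sum_le_sum fun y _ => min_sum_le_sum_min _ hb fun m _ => hprod m y
    _ ≤ ∑ y, ∑ m, b ^ (1 - k⁻¹) * ((∑ i, f m i y) / k) := by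
        gcongr with y _ m _
        exact (min_le_rpow_mul_rpow hb (hprod m y) (by positivity) (inv_le_one_of_one_le₀ hk)).trans
          (mul_le_mul_of_nonneg_left (hmean m y) (by positivity))
    _ = Fintype.card M * b ^ (1 - k⁻¹) := by
        rw [Finset.sum_comm]
        simp only [← Finset.mul_sum, hsum, mul_one, Finset.sum_const, Finset.card_univ,
          nsmul_eq_mul]

theorem sum_min_sum_mul_le_sqrt {U Y : Type*} [Fintype U] [Fintype Y] {f g : U → Y → ℝ}
    (hf : ∀ u y, 0 ≤ f u y) (hf1 : ∀ u, ∑ y, f u y = 1) (hg : ∀ u y, 0 ≤ g u y)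
    (hg1 : ∑ u, ∑ y, g u y = 1) {b : ℝ} (hb : 0 ≤ b) :
    ∑ y, min (∑ u, f u y * g u y) b ≤ √(Fintype.card U * b) := by
  have hcap (u : U) (y : Y) : min (f u y * g u y) b ≤ √(f u y * b) * √(g u y) := by
    have hfg : 0 ≤ f u y * g u y := mul_nonneg (hf u y) (hg u y)
    rw [← Real.sqrt_mul (mul_nonneg (hf u y) hb), mul_right_comm]
    refine Real.le_sqrt_of_sq_le ?_
    rw [sq]
    exact mul_le_mul (min_le_left _ _) (min_le_right _ _) (le_min hfg hb) hfg
  calc ∑ y, min (∑ u, f u y * g u y) b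
      ≤ ∑ y, ∑ u, √(f u y * b) * √(g u y) := by
        gcongr with y
        exact (min_sum_le_sum_min _ hb fun u _ => mul_nonneg (hf u y) (hg u y)).trans
          (Finset.sum_le_sum fun u _ => hcap u y)
    _ = ∑ x : U × Y, √(f x.1 x.2 * b) * √(g x.1 x.2) := by
        rw [Finset.sum_comm, Fintype.sum_prod_type]
    _ ≤ √(∑ x : U × Y, f x.1 x.2 * b) * √(∑ x : U × Y, g x.1 x.2) :=
        Real.sum_sqrt_mul_sqrt_le _ (fun x => mul_nonneg (hf _ _) hb) fun x => hg _ _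
    _ = √(Fintype.card U * b) := by
        simp only [Fintype.sum_prod_type, hg1, ← Finset.sum_mul, hf1, Finset.sum_const,
          Finset.card_univ, nsmul_eq_mul, mul_one, Real.sqrt_one]

end Inequalities

section FiniteLaws

theorem sum_toReal_pmf {β : Type*} [Fintype β] (p : PMF β) : ∑ b, (p b).toReal = 1 := by
  rw [← ENNReal.toReal_sum fun b _ => p.apply_ne_top b, ← tsum_fintype (L := .unconditional β),
    p.tsum_coe, ENNReal.toReal_one]

theorem toReal_pmf_le_one {β : Type*} (p : PMF β) (b : β) : (p b).toReal ≤ 1 :=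
  ENNReal.toReal_mono ENNReal.one_ne_top (p.coe_le_one b)

theorem sum_toReal_pmf_map_mul {β γ : Type*} [Fintype β] [Fintype γ] (p : PMF β) (f : β → γ)
    (h : γ → ℝ) : ∑ c, (p.map f c).toReal * h c = ∑ b, (p b).toReal * h (f b) := by
  let _ : MeasurableSpace β := ⊤
  let _ : MeasurableSpace γ := ⊤
  simp only [← smul_eq_mul, ← PMF.integral_eq_sum]
  rw [← PMF.toMeasure_map f p (measurable_of_finite f),
    MeasureTheory.integral_map (measurable_of_finite f).aemeasurable
      (measurable_of_finite h).aestronglyMeasurable]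

end FiniteLaws

section Spectrum

variable {α : Type*} [Fintype α]

theorem entropyBits_nonneg (p : PMF α) : 0 ≤ entropyBits p :=
  neg_nonneg.2 <| Finset.sum_nonpos fun a _ =>
    mul_nonpos_of_nonneg_of_nonpos ENNReal.toReal_nonneg
      (Real.logb_nonpos one_lt_two ENNReal.toReal_nonneg (toReal_pmf_le_one p a))

theorem hasDerivAt_rpow_one_add {u : ℝ} (hu : 0 ≤ u) :
    HasDerivAt (fun s : ℝ => u ^ (1 + s)) (u * Real.log u) 0 := by
  rcases hu.eq_or_lt with rfl | hu
  · have hzero : (fun s : ℝ => (0 : ℝ) ^ (1 + s)) =ᶠ[𝓝 0] fun _ => 0 := by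
      filter_upwards [lt_mem_nhds neg_one_lt_zero] with s hs
      exact Real.zero_rpow (by linarith)
    simpa using (hasDerivAt_const (0 : ℝ) (0 : ℝ)).congr_of_eventuallyEq hzero
  · simpa [mul_comm] using ((hasDerivAt_id (0 : ℝ)).const_add 1).const_rpow hu

/-- The moment `E[(p(X) 2 ^ c) ^ s]` for `X` with law `p`. Its `n`-th power controls the probability
that the `n`-fold product law is above (`s > 0`) or below (`s < 0`) the level `2 ^ (-n c)`. -/
noncomputable def tiltedMoment (p : PMF α) (c s : ℝ) : ℝ :=
  ∑ a, (p a).toReal ^ (1 + s) * (2 : ℝ) ^ (s * c)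

theorem tiltedMoment_nonneg (p : PMF α) (c s : ℝ) : 0 ≤ tiltedMoment p c s :=
  Finset.sum_nonneg fun _ _ => by positivity

theorem tiltedMoment_zero (p : PMF α) (c : ℝ) : tiltedMoment p c 0 = 1 := by
  simp [tiltedMoment, sum_toReal_pmf]

theorem hasDerivAt_tiltedMoment_zero (p : PMF α) (c : ℝ) :
    HasDerivAt (tiltedMoment p c) (Real.log 2 * (c - entropyBits p)) 0 := by
  have hpow : HasDerivAt (fun s : ℝ => (2 : ℝ) ^ (s * c)) (c * Real.log 2) 0 := by
    simpa [mul_comm] using ((hasDerivAt_id (0 : ℝ)).mul_const c).const_rpow two_pos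
  have hsum := HasDerivAt.fun_sum (u := Finset.univ) fun (a : α) _ =>
    (hasDerivAt_rpow_one_add (ENNReal.toReal_nonneg (a := p a))).mul hpow
  refine hsum.congr_deriv ?_
  have hlog : Real.log 2 ≠ 0 := (Real.log_pos one_lt_two).ne'
  have hent : Real.log 2 * entropyBits p = -∑ a, (p a).toReal * Real.log (p a).toReal := by
    rw [entropyBits, mul_neg, Finset.mul_sum]
    simp only [Real.logb]
    field_simp
  simp only [zero_mul, Real.rpow_zero, mul_one, add_zero, Real.rpow_one, Finset.sum_add_distrib,
    ← Finset.sum_mul, sum_toReal_pmf]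
  linarith

theorem exists_pos_tiltedMoment_lt_one (p : PMF α) {c : ℝ} (hc : c < entropyBits p) :
    ∃ s : ℝ, 0 < s ∧ tiltedMoment p c s < 1 := by
  have hderiv := hasDerivAt_tiltedMoment_zero p c
  have hneg : deriv (fun s => tiltedMoment p c s - 1) 0 < 0 := by
    rw [(hderiv.sub_const 1).deriv]
    exact mul_neg_of_pos_of_neg (Real.log_pos one_lt_two) (sub_neg.2 hc)
  have hsign := eventually_nhdsWithin_sign_eq_of_deriv_neg hneg (by simp [tiltedMoment_zero])
  obtain ⟨s, hs, (hs0 : 0 < s)⟩ :=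
    ((hsign.filter_mono nhdsWithin_le_nhds).and (self_mem_nhdsWithin (s := Set.Ioi 0))).exists
  rw [sign_neg (zero_sub s ▸ neg_lt_zero.2 hs0 : 0 - s < 0), sign_eq_neg_one_iff, sub_neg] at hs
  exact ⟨s, hs0, hs⟩

theorem exists_neg_tiltedMoment_lt_one (p : PMF α) {c : ℝ} (hc : entropyBits p < c) :
    ∃ s : ℝ, 0 < s ∧ s < 1 ∧ tiltedMoment p c (-s) < 1 := by
  have hderiv := hasDerivAt_tiltedMoment_zero p c
  have hpos : 0 < deriv (fun s => tiltedMoment p c s - 1) 0 := by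
    rw [(hderiv.sub_const 1).deriv]
    exact mul_pos (Real.log_pos one_lt_two) (sub_pos.2 hc)
  have hsign := eventually_nhdsWithin_sign_eq_of_deriv_pos hpos (by simp [tiltedMoment_zero])
  obtain ⟨s, hs, hs1, hs0⟩ := ((hsign.filter_mono nhdsWithin_le_nhds).and
    (Ioo_mem_nhdsLT (neg_one_lt_zero (R := ℝ)))).exists
  rw [sign_neg (by linarith : s - 0 < 0), sign_eq_neg_one_iff, sub_neg] at hs
  exact ⟨-s, by linarith, by linarith, by rwa [neg_neg]⟩

/-- The `n`-fold product of the p.m.f. `p`, as a real-valued function. -/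
noncomputable def blockLaw {α : Type*} (p : PMF α) (n : ℕ) (y : Fin n → α) : ℝ :=
  ∏ k, (p (y k)).toReal

theorem blockLaw_nonneg {α : Type*} (p : PMF α) (n : ℕ) (y : Fin n → α) : 0 ≤ blockLaw p n y :=
  Finset.prod_nonneg fun _ _ => ENNReal.toReal_nonneg

theorem sum_blockLaw (p : PMF α) (n : ℕ) : ∑ y, blockLaw p n y = 1 := by
  simp only [blockLaw, ← Fintype.sum_pow (fun a => (p a).toReal) n, sum_toReal_pmf, one_pow]

theorem sum_blockLaw_rpow_mul (p : PMF α) (n : ℕ) (c s : ℝ) :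
    ∑ y, blockLaw p n y ^ (1 + s) * ((2 : ℝ) ^ (-(n * c))) ^ (-s) = tiltedMoment p c s ^ n := by
  rw [tiltedMoment, Fintype.sum_pow]
  refine Finset.sum_congr rfl fun y _ => ?_
  rw [Finset.prod_mul_distrib, Finset.prod_const, Finset.card_univ, Fintype.card_fin, blockLaw,
    Real.finsetProd_rpow _ _ fun _ _ => ENNReal.toReal_nonneg, ← Real.rpow_natCast,
    ← Real.rpow_mul two_pos.le, ← Real.rpow_mul two_pos.le]
  congr 2
  ring

theorem tendsto_sum_min_blockLaw_of_lt_entropyBits (p : PMF α) {c : ℝ} (hc : c < entropyBits p) :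
    Tendsto (fun n : ℕ => ∑ y, min (blockLaw p n y) ((2 : ℝ) ^ (-(n * c)))) atTop (𝓝 1) := by
  obtain ⟨s, hs0, hs⟩ := exists_pos_tiltedMoment_lt_one p hc
  have hpow := tendsto_pow_atTop_nhds_zero_of_lt_one (tiltedMoment_nonneg p c s) hs
  have hlower := hpow.const_sub 1
  rw [sub_zero] at hlower
  refine tendsto_of_tendsto_of_tendsto_of_le_of_le hlower tendsto_const_nhds
    (fun n => ?_) fun n => ?_
  · simp only
    rw [sub_le_comm, ← sum_blockLaw p n, ← Finset.sum_sub_distrib, ← sum_blockLaw_rpow_mul]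
    gcongr with y
    exact sub_min_le_rpow_mul_rpow_neg (blockLaw_nonneg p n y) (by positivity) hs0.le
  · exact (Finset.sum_le_sum fun y _ => min_le_left _ _).trans_eq (sum_blockLaw p n)

theorem tendsto_sum_min_blockLaw_of_entropyBits_lt (p : PMF α) {c C : ℝ} (hc : entropyBits p < c)
    (hC : 0 ≤ C) {d : ℕ → ℝ} (hd0 : ∀ n, 0 ≤ d n) (hd : ∀ n : ℕ, d n ≤ C * (2 : ℝ) ^ (-(n * c))) :
    Tendsto (fun n : ℕ => ∑ y, min (blockLaw p n y) (d n)) atTop (𝓝 0) := by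
  obtain ⟨s, hs0, hs1, hs⟩ := exists_neg_tiltedMoment_lt_one p hc
  have hpow := (tendsto_pow_atTop_nhds_zero_of_lt_one (tiltedMoment_nonneg p c (-s)) hs).const_mul
    (C ^ s)
  rw [mul_zero] at hpow
  refine squeeze_zero (fun n => Finset.sum_nonneg fun y _ => le_min (blockLaw_nonneg p n y) (hd0 n))
    (fun n => ?_) hpow
  rw [← sum_blockLaw_rpow_mul, neg_neg, ← sub_eq_add_neg, Finset.mul_sum]
  gcongr with y
  calc min (blockLaw p n y) (d n) ≤ blockLaw p n y ^ (1 - s) * d n ^ s :=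
        min_le_rpow_mul_rpow (blockLaw_nonneg p n y) (hd0 n) hs0.le hs1.le
    _ ≤ blockLaw p n y ^ (1 - s) * (C * (2 : ℝ) ^ (-(n * c))) ^ s := by
        gcongr
        · exact Real.rpow_nonneg (blockLaw_nonneg p n y) _
        · exact hd0 n
        · exact hd n
    _ = C ^ s * (blockLaw p n y ^ (1 - s) * ((2 : ℝ) ^ (-(n * c))) ^ s) := by
        rw [Real.mul_rpow hC (by positivity)]
        ring

end Spectrum

namespace SimulationCode

section General

variable {t h : ℕ} {V : Fin t → Finset (Fin h)} {A : Fin t → Type*} {n K : ℕ} {L : Fin h → ℕ}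

theorem induced_nonneg (c : SimulationCode V A n K L) (x : ∀ i, Fin n → A i) :
    0 ≤ c.induced x :=
  Finset.sum_nonneg fun _ _ => Finset.sum_nonneg fun _ _ => by positivity

theorem sum_sum_coordinator_div (c : SimulationCode V A n K L) (hL : ∀ j, 0 < L j) :
    ∑ w, ∑ m, (c.coordinator w m).toReal / ∏ j, (L j : ℝ) = 1 := by
  simp only [← Finset.sum_div, sum_toReal_pmf, Finset.sum_const, Finset.card_univ,
    Fintype.card_pi, Fintype.card_fin, nsmul_eq_mul, mul_one, Nat.cast_prod]
  exact div_self (Finset.prod_ne_zero_iff.2 fun j _ => Nat.cast_ne_zero.2 (hL j).ne')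

theorem sum_induced [∀ i, Fintype (A i)] (c : SimulationCode V A n K L) (hL : ∀ j, 0 < L j) :
    ∑ x, c.induced x = 1 := by
  simp only [induced]
  rw [Finset.sum_comm, ← c.sum_sum_coordinator_div hL]
  refine Finset.sum_congr rfl fun w _ => ?_
  rw [Finset.sum_comm]
  refine Finset.sum_congr rfl fun m _ => ?_
  rw [← Finset.sum_div, ← Finset.mul_sum,
    ← Fintype.prod_sum fun i (y : Fin n → A i) => (c.processor i m (fun j => w j) y).toReal]
  simp only [sum_toReal_pmf, Finset.prod_const_one, mul_one]

/-- The joint law of the observation `u` of processor `i` (the message and the values of the sources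
that it has access to) and of the output `y` of processor `j`. -/
noncomputable def observationOutputLaw (c : SimulationCode V A n K L) (i j : Fin t)
    (u : Fin K × (∀ k : V i, Fin (L k))) (y : Fin n → A j) : ℝ :=
  ∑ w with (fun k : V i => w k) = u.2,
    (c.coordinator w u.1).toReal * (c.processor j u.1 (fun k => w k) y).toReal / ∏ k, (L k : ℝ)

theorem observationOutputLaw_nonneg (c : SimulationCode V A n K L) (i j : Fin t)
    (u : Fin K × (∀ k : V i, Fin (L k))) (y : Fin n → A j) :
    0 ≤ c.observationOutputLaw i j u y :=
  Finset.sum_nonneg fun _ _ => by positivity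

theorem sum_observationOutputLaw (c : SimulationCode V A n K L) (hL : ∀ j, 0 < L j) (i j : Fin t)
    [Fintype (A j)] : ∑ u, ∑ y, c.observationOutputLaw i j u y = 1 := by
  have hmarginal (u : Fin K × ∀ k : V i, Fin (L k)) : ∑ y, c.observationOutputLaw i j u y =
      ∑ w with (fun k : V i => w k) = u.2, (c.coordinator w u.1).toReal / ∏ k, (L k : ℝ) := by
    simp only [observationOutputLaw]
    rw [Finset.sum_comm]
    simp only [← Finset.sum_div, ← Finset.mul_sum, sum_toReal_pmf, mul_one]
  simp only [hmarginal, Fintype.sum_prod_type]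
  rw [← c.sum_sum_coordinator_div hL,
    Finset.sum_comm (s := (Finset.univ : Finset (∀ k, Fin (L k))))]
  exact Finset.sum_congr rfl fun m _ => Finset.sum_fiberwise _ _ _

theorem induced_le_sum_observationOutputLaw (c : SimulationCode V A n K L) {i j : Fin t}
    (hij : i ≠ j) (x : ∀ i, Fin n → A i) :
    c.induced x ≤
      ∑ u, (c.processor i u.1 u.2 (x i)).toReal * c.observationOutputLaw i j u (x j) := by
  have hprod (w : ∀ k, Fin (L k)) (m : Fin K) :
      ∏ k, (c.processor k m (fun l => w l) (x k)).toReal ≤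
        (c.processor i m (fun l => w l) (x i)).toReal *
          (c.processor j m (fun l => w l) (x j)).toReal := by
    rw [← Finset.prod_pair (f := fun k => (c.processor k m (fun l => w l) (x k)).toReal) hij]
    exact Finset.prod_le_prod_of_subset_of_le_one (Finset.subset_univ _)
      (fun k _ => ENNReal.toReal_nonneg) fun k _ _ => toReal_pmf_le_one _ _
  rw [induced, Finset.sum_comm, Fintype.sum_prod_type]
  refine Finset.sum_le_sum fun m _ => ?_
  simp only [observationOutputLaw]
  rw [← Finset.sum_fiberwise Finset.univ fun (w : ∀ k, Fin (L k)) (k : V i) => w k]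
  refine Finset.sum_le_sum fun v _ => ?_
  rw [Finset.mul_sum]
  refine Finset.sum_le_sum fun w hw => ?_
  rw [← (Finset.mem_filter.1 hw).2, ← mul_div_assoc, mul_left_comm]
  gcongr
  exact hprod w m

theorem sum_min_induced_le_sqrt {β : Type*} [Fintype β] (c : SimulationCode V (fun _ => β) n K L)
    (hL : ∀ j, 0 < L j) {i j : Fin t} (hij : i ≠ j) {b : ℝ} (hb : 0 ≤ b) :
    ∑ y : Fin n → β, min (c.induced fun _ => y) b ≤ √(K * (∏ k ∈ V i, (L k : ℝ)) * b) := by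
  calc ∑ y : Fin n → β, min (c.induced fun _ => y) b
      ≤ ∑ y, min (∑ u, (c.processor i u.1 u.2 y).toReal * c.observationOutputLaw i j u y) b := by
        gcongr with y
        exact c.induced_le_sum_observationOutputLaw hij fun _ => y
    _ ≤ √(Fintype.card (Fin K × ∀ k : V i, Fin (L k)) * b) :=
        sum_min_sum_mul_le_sqrt (fun _ _ => ENNReal.toReal_nonneg) (fun _ => sum_toReal_pmf _)
          (c.observationOutputLaw_nonneg i j) (c.sum_observationOutputLaw hL i j) hb
    _ = √(K * (∏ k ∈ V i, (L k : ℝ)) * b) := by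
        rw [← Finset.prod_coe_sort]
        simp

end General

section IndividualAccess

variable {t : ℕ} {A : Fin t → Type*} {n K : ℕ} {L : Fin t → ℕ}

/-- The random map of processor `i` as a function of the message and of the value of its source. -/
noncomputable def kernel (c : SimulationCode (individualAccess t) A n K L) (i : Fin t) (m : Fin K)
    (v : Fin (L i)) : PMF (Fin n → A i) :=
  c.processor i m fun j => Fin.cast (congrArg L (Finset.mem_singleton.1 j.2).symm) v

theorem processor_eq_kernel (c : SimulationCode (individualAccess t) A n K L) (i : Fin t)
    (m : Fin K) (w : ∀ j, Fin (L j)) : (c.processor i m fun j => w j) = c.kernel i m (w i) := by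
  refine congrArg (c.processor i m) (funext ?_)
  rintro ⟨j, hj⟩
  obtain rfl : j = i := Finset.mem_singleton.1 hj
  rfl

/-- The law of the output of processor `i` when its source is uniform and independent of the
message `m`. -/
noncomputable def meanOutputLaw (c : SimulationCode (individualAccess t) A n K L) (i : Fin t)
    (m : Fin K) (y : Fin n → A i) : ℝ :=
  (∑ v, (c.kernel i m v y).toReal) / L i

theorem meanOutputLaw_nonneg (c : SimulationCode (individualAccess t) A n K L) (i : Fin t)
    (m : Fin K) (y : Fin n → A i) : 0 ≤ c.meanOutputLaw i m y :=
  div_nonneg (Finset.sum_nonneg fun _ _ => ENNReal.toReal_nonneg) (Nat.cast_nonneg _)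

theorem sum_meanOutputLaw (c : SimulationCode (individualAccess t) A n K L) {i : Fin t}
    [Fintype (A i)] (hL : 0 < L i) (m : Fin K) : ∑ y, c.meanOutputLaw i m y = 1 := by
  simp only [meanOutputLaw]
  rw [← Finset.sum_div, Finset.sum_comm]
  simp only [sum_toReal_pmf, Finset.sum_const, Finset.card_univ, Fintype.card_fin, nsmul_eq_mul,
    mul_one]
  exact div_self (Nat.cast_ne_zero.2 hL.ne')

theorem induced_le_sum_prod_meanOutputLaw (c : SimulationCode (individualAccess t) A n K L)
    (x : ∀ i, Fin n → A i) : c.induced x ≤ ∑ m, ∏ i, c.meanOutputLaw i m (x i) := by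
  have hprod (m : Fin K) : ∏ i, c.meanOutputLaw i m (x i) =
      ∑ w : (∀ j, Fin (L j)), (∏ i, (c.kernel i m (w i) (x i)).toReal) / ∏ j, (L j : ℝ) := by
    simp only [meanOutputLaw]
    rw [Finset.prod_div_distrib, Fintype.prod_sum, Finset.sum_div]
  simp only [hprod]
  rw [induced, Finset.sum_comm]
  gcongr with m _ w _
  simp only [processor_eq_kernel]
  exact mul_le_of_le_one_left (by positivity) (toReal_pmf_le_one _ _)

theorem sum_min_induced_le_rpow [NeZero t] {β : Type*} [Fintype β]
    (c : SimulationCode (individualAccess t) (fun _ => β) n K L) (hL : ∀ j, 0 < L j) {b : ℝ}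
    (hb : 0 ≤ b) :
    ∑ y : Fin n → β, min (c.induced fun _ => y) b ≤ K * b ^ (1 - (t : ℝ)⁻¹) := by
  calc ∑ y : Fin n → β, min (c.induced fun _ => y) b
      ≤ ∑ y, min (∑ m, ∏ i, c.meanOutputLaw i m y) b := by
        gcongr with y
        exact c.induced_le_sum_prod_meanOutputLaw fun _ => y
    _ ≤ K * b ^ (1 - (t : ℝ)⁻¹) := by
        simpa only [Fintype.card_fin] using sum_min_sum_prod_le
          (fun m i y => c.meanOutputLaw_nonneg i m y) (fun m i => c.sum_meanOutputLaw (hL i) m) hb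

end IndividualAccess

end SimulationCode

section Rates

theorem indexSize_pos (n : ℕ) {R : ℝ} (hR : 0 ≤ R) : 0 < indexSize n R :=
  Nat.floor_pos.2 (Real.one_le_rpow one_le_two (by positivity))

theorem indexSize_le (n : ℕ) (R : ℝ) : (indexSize n R : ℝ) ≤ 2 ^ (n * R) :=
  Nat.floor_le (by positivity)

theorem half_le_indexSize (n : ℕ) {R : ℝ} (hR : 0 ≤ R) :
    (2 : ℝ) ^ (n * R) / 2 ≤ indexSize n R := by
  have hpos : (1 : ℝ) ≤ indexSize n R := Nat.one_le_cast.2 (indexSize_pos n hR)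
  have hfloor : (2 : ℝ) ^ (n * R) < indexSize n R + 1 := Nat.lt_floor_add_one _
  linarith

theorem tendsto_two_rpow_nat_mul {e : ℝ} (he : e < 0) :
    Tendsto (fun n : ℕ => (2 : ℝ) ^ (n * e)) atTop (𝓝 0) := by
  refine (tendsto_pow_atTop_nhds_zero_of_lt_one (r := (2 : ℝ) ^ e) (by positivity)
    (Real.rpow_lt_one_of_one_lt_of_neg one_lt_two he)).congr fun n => ?_
  rw [← Real.rpow_natCast, ← Real.rpow_mul two_pos.le, mul_comm]

/-- The fraction of `[1 : L]` that is covered by `l` disjoint classes of the maximal common size.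
It is the probability with which a uniform element of `[1 : l]` can be extracted from one of
`[1 : L]`. -/
noncomputable def usableFraction (l L : ℕ) : ℝ := ((l * (L / l) : ℕ) : ℝ) / L

theorem usableFraction_nonneg (l L : ℕ) : 0 ≤ usableFraction l L := by
  unfold usableFraction
  positivity

theorem usableFraction_le_one (l L : ℕ) : usableFraction l L ≤ 1 :=
  div_le_one_of_le₀ (Nat.cast_le.2 (Nat.mul_div_le L l)) (Nat.cast_nonneg _)

theorem one_sub_div_le_usableFraction {l L : ℕ} (hl : 0 < l) (hL : 0 < L) :
    1 - (l : ℝ) / L ≤ usableFraction l L := by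
  have hL' : (0 : ℝ) < L := Nat.cast_pos.2 hL
  have hmod : L ≤ l * (L / l) + l := by
    have := Nat.div_add_mod L l
    have := Nat.mod_lt L hl
    lia
  rw [usableFraction, one_sub_div hL'.ne']
  gcongr
  rw [sub_le_iff_le_add]
  exact_mod_cast hmod

theorem tendsto_usableFraction_indexSize {a b : ℝ} (ha : 0 ≤ a) (hab : a < b) :
    Tendsto (fun n : ℕ => usableFraction (indexSize n a) (indexSize n b)) atTop (𝓝 1) := by
  have hb : 0 ≤ b := ha.trans hab.le
  have hlower := ((tendsto_two_rpow_nat_mul (sub_neg.2 hab)).const_mul 2).const_sub 1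
  rw [mul_zero, sub_zero] at hlower
  refine tendsto_of_tendsto_of_tendsto_of_le_of_le hlower tendsto_const_nhds (fun n => ?_)
    fun n => usableFraction_le_one _ _
  refine le_trans ?_ (one_sub_div_le_usableFraction (indexSize_pos n ha) (indexSize_pos n hb))
  refine sub_le_sub_left ?_ 1
  calc (indexSize n a : ℝ) / indexSize n b ≤ 2 ^ (n * a) / (2 ^ (n * b) / 2) := by
        gcongr
        · exact indexSize_le n a
        · exact half_le_indexSize n hb
    _ = 2 * (2 : ℝ) ^ (n * (a - b)) := by
        rw [mul_sub, Real.rpow_sub two_pos]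
        field_simp

end Rates

section DiagonalLaw

variable {t : ℕ} {α : Type*}

theorem sum_iidLaw {A : Fin t → Type*} [∀ i, Fintype (A i)] (q : PMF (∀ i, A i)) (n : ℕ) :
    ∑ x, iidLaw q n x = 1 := by
  rw [← sum_blockLaw q n]
  exact Fintype.sum_equiv (Equiv.piComm _) _ _ fun x => rfl

/-- The joint law of `t` copies of a random variable with law `p`. -/
noncomputable def diagonalLaw (t : ℕ) (p : PMF α) : PMF (Fin t → α) := p.map fun a _ => a

theorem eq_diagonalLaw {q : PMF (Fin t → α)} (hq : ∀ x ∈ q.support, ∀ i j : Fin t, x i = x j)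
    (i : Fin t) : q = diagonalLaw t (q.map fun x => x i) := by
  rw [diagonalLaw, PMF.map_comp]
  conv_lhs => rw [← PMF.bind_pure q]
  ext y
  rw [PMF.map, PMF.bind_apply, PMF.bind_apply]
  refine tsum_congr fun x => ?_
  by_cases hx : q x = 0
  · rw [hx, zero_mul, zero_mul]
  · have hconst : (fun _ => x i) = x := funext fun j => hq x ((q.mem_support_iff x).2 hx) i j
    simp only [Function.comp_apply, hconst]

theorem const_injective [NeZero t] {β : Type*} :
    Function.Injective fun (y : β) (_ : Fin t) => y :=
  fun _ _ h => congrFun h 0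

theorem diagonalLaw_apply_const [NeZero t] (p : PMF α) (a : α) :
    diagonalLaw t p (fun _ => a) = p a := by
  rw [diagonalLaw, PMF.map_apply, tsum_eq_single a fun b hb => if_neg ?_]
  · exact if_pos rfl
  · exact fun hab => hb (const_injective hab).symm

theorem iidLaw_diagonalLaw_const [NeZero t] (p : PMF α) (n : ℕ) (y : Fin n → α) :
    iidLaw (A := fun _ => α) (diagonalLaw t p) n (fun _ => y) = blockLaw p n y :=
  Finset.prod_congr rfl fun k _ => congrArg ENNReal.toReal (diagonalLaw_apply_const p (y k))

theorem iidLaw_diagonalLaw_eq_zero [NeZero t] (p : PMF α) {n : ℕ} {x : Fin t → Fin n → α}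
    (hx : x ∉ Set.range fun (y : Fin n → α) (_ : Fin t) => y) :
    iidLaw (A := fun _ => α) (diagonalLaw t p) n x = 0 := by
  contrapose! hx
  refine ⟨x 0, funext fun i => funext fun k => ?_⟩
  have hk : diagonalLaw t p (fun i => x i k) ≠ 0 := fun hk =>
    Finset.prod_ne_zero_iff.1 hx k (Finset.mem_univ k) (by rw [hk, ENNReal.toReal_zero])
  obtain ⟨a, -, ha⟩ := (PMF.mem_support_map_iff _ _ _).1 ((PMF.mem_support_iff _ _).2 hk)
  exact (congrFun ha 0).symm.trans (congrFun ha i)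

variable [Fintype α] [NeZero t] {p : PMF α}

theorem sum_min_blockLaw_le (p : PMF α) {n : ℕ} (P : (Fin t → Fin n → α) → ℝ) (b : ℝ) :
    ∑ y, min (blockLaw p n y) b ≤ ∑ y : Fin n → α, min (P fun _ => y) b +
      ∑ x, |P x - iidLaw (A := fun _ => α) (diagonalLaw t p) n x| := by
  have hmin (u v : ℝ) : min u b ≤ min v b + |v - u| := by
    rw [← min_add_add_right]
    refine min_le_min ?_ (le_add_of_nonneg_right (abs_nonneg _))
    linarith [neg_abs_le (v - u)]
  calc ∑ y, min (blockLaw p n y) b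
      ≤ ∑ y, (min (P fun _ => y) b + |P (fun _ => y) - blockLaw p n y|) :=
        Finset.sum_le_sum fun y _ => hmin _ _
    _ = ∑ y, min (P fun _ => y) b +
          ∑ y, |P (fun _ => y) - iidLaw (A := fun _ => α) (diagonalLaw t p) n fun _ => y| := by
        simp only [Finset.sum_add_distrib, iidLaw_diagonalLaw_const]
    _ ≤ _ := by
        gcongr
        exact sum_comp_le_sum_of_injective const_injective
          (f := fun x => |P x - iidLaw (A := fun _ => α) (diagonalLaw t p) n x|)
          fun _ => abs_nonneg _

theorem sum_abs_sub_iidLaw_diagonalLaw (p : PMF α) {n : ℕ} {P : (Fin t → Fin n → α) → ℝ}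
    (hP : ∀ x, 0 ≤ P x) (hP1 : ∑ x, P x = 1) :
    ∑ x, |P x - iidLaw (A := fun _ => α) (diagonalLaw t p) n x| =
      2 * ∑ y, (blockLaw p n y - P fun _ => y)⁺ := by
  rw [sum_abs_sub_eq_two_mul_sum_posPart _ (hP1.trans (sum_iidLaw _ n).symm)]
  congr 1
  refine (Fintype.sum_of_injective _ const_injective _ _ (fun x hx => ?_) fun y => ?_).symm
  · rw [iidLaw_diagonalLaw_eq_zero p hx, zero_sub, posPart_eq_zero]
    exact neg_nonpos.2 (hP x)
  · rw [iidLaw_diagonalLaw_const]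

end DiagonalLaw

section Converse

variable {t : ℕ} {α : Type*} [Fintype α] {p : PMF α}

theorem exponent_nonneg_of_tendsto [NeZero t] (P : ∀ n, (Fin t → Fin n → α) → ℝ)
    (hP : Tendsto (fun n => ∑ x, |P n x - iidLaw (A := fun _ => α) (diagonalLaw t p) n x|) atTop
      (𝓝 0)) {c e : ℝ} (hc : c < entropyBits p)
    (hmin : ∀ n : ℕ, ∑ y : Fin n → α, min (P n fun _ => y) ((2 : ℝ) ^ (-(n * c))) ≤
      (2 : ℝ) ^ (n * e)) : 0 ≤ e := by
  by_contra! he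
  have hupper := (tendsto_two_rpow_nat_mul he).add hP
  rw [add_zero] at hupper
  refine zero_lt_one.not_ge (le_of_tendsto_of_tendsto'
    (tendsto_sum_min_blockLaw_of_lt_entropyBits p hc) hupper fun n => ?_)
  exact (sum_min_blockLaw_le p (P n) _).trans (add_le_add_left (hmin n) _)

theorem IsAchievable.entropyBits_le_message (ht : 2 ≤ t) {R : ℝ} {Rs : Fin t → ℝ}
    (h : IsAchievable (individualAccess t) (diagonalLaw t p) R Rs) :
    ((t : ℝ) - 1) * entropyBits p / t ≤ R := by
  obtain ⟨-, hRs, c, hc⟩ := h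
  have : NeZero t := ⟨by lia⟩
  have ht1 : (1 : ℝ) < t := Nat.one_lt_cast.2 ht
  have hθ : 0 < 1 - (t : ℝ)⁻¹ := sub_pos.2 (inv_lt_one_of_one_lt₀ ht1)
  have hcap : ∀ e < entropyBits p, 0 ≤ R - e * (1 - (t : ℝ)⁻¹) := by
    intro e he
    refine exponent_nonneg_of_tendsto (fun n => (c n).induced) hc he fun n => ?_
    calc ∑ y, min ((c n).induced fun _ => y) ((2 : ℝ) ^ (-(n * e)))
        ≤ indexSize n R * ((2 : ℝ) ^ (-(n * e))) ^ (1 - (t : ℝ)⁻¹) :=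
          (c n).sum_min_induced_le_rpow (fun i => indexSize_pos n (hRs i)) (by positivity)
      _ ≤ 2 ^ (n * R) * ((2 : ℝ) ^ (-(n * e))) ^ (1 - (t : ℝ)⁻¹) := by
          gcongr
          exact indexSize_le n R
      _ = 2 ^ (n * (R - e * (1 - (t : ℝ)⁻¹))) := by
          rw [← Real.rpow_mul two_pos.le, ← Real.rpow_add two_pos]
          congr 1
          ring
  have hle : entropyBits p ≤ R / (1 - (t : ℝ)⁻¹) :=
    le_of_forall_lt_imp_le_of_dense fun e he => (le_div_iff₀ hθ).2 (sub_nonneg.1 (hcap e he))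
  calc ((t : ℝ) - 1) * entropyBits p / t = entropyBits p * (1 - (t : ℝ)⁻¹) := by field_simp
    _ ≤ R := (le_div_iff₀ hθ).1 hle

theorem IsAchievable.entropyBits_le_add_sum {h : ℕ} {V : Fin t → Finset (Fin h)} {R : ℝ}
    {Rs : Fin h → ℝ} (hach : IsAchievable V (diagonalLaw t p) R Rs) {i j : Fin t} (hij : i ≠ j) :
    entropyBits p ≤ R + ∑ k ∈ V i, Rs k := by
  obtain ⟨-, hRs, c, hc⟩ := hach
  have : NeZero t := ⟨i.pos.ne'⟩
  refine le_of_forall_lt_imp_le_of_dense fun e he => ?_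
  suffices 0 ≤ (R + ∑ k ∈ V i, Rs k - e) / 2 by linarith
  refine exponent_nonneg_of_tendsto (fun n => (c n).induced) hc he fun n => ?_
  refine ((c n).sum_min_induced_le_sqrt (fun k => indexSize_pos n (hRs k)) hij
    (by positivity)).trans (Real.sqrt_le_iff.2 ⟨by positivity, ?_⟩)
  calc (indexSize n R : ℝ) * (∏ k ∈ V i, (indexSize n (Rs k) : ℝ)) * 2 ^ (-(n * e))
      ≤ 2 ^ (n * R) * (∏ k ∈ V i, (2 : ℝ) ^ (n * Rs k)) * 2 ^ (-(n * e)) := by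
        gcongr <;> exact indexSize_le _ _
    _ = ((2 : ℝ) ^ (n * ((R + ∑ k ∈ V i, Rs k - e) / 2))) ^ 2 := by
        rw [← Real.rpow_natCast, ← Real.rpow_mul two_pos.le, ← Real.rpow_sum_of_pos two_pos,
          ← Real.rpow_add two_pos, ← Real.rpow_add two_pos, ← Finset.mul_sum]
        congr 1
        push_cast
        ring

theorem IsAchievable.entropyBits_le_add (ht : 2 ≤ t) {R : ℝ} {Rs : Fin t → ℝ}
    (h : IsAchievable (individualAccess t) (diagonalLaw t p) R Rs) (i : Fin t) :
    entropyBits p ≤ R + Rs i := by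
  have : Nontrivial (Fin t) := Fin.nontrivial_iff_two_le.2 ht
  obtain ⟨j, hj⟩ := exists_ne i
  simpa only [individualAccess, Finset.sum_singleton] using h.entropyBits_le_add_sum hj.symm

end Converse

section Quantization

theorem exists_map_card_fiber_ge {Z β : Type*} [Fintype Z] [Fintype β] [DecidableEq β] [Nonempty β]
    {m : β → ℕ} (hm : ∑ y, m y ≤ Fintype.card Z) : ∃ φ : Z → β, ∀ y, m y ≤ #{z | φ z = y} := by
  obtain ⟨e⟩ : Nonempty ((Σ y, Fin (m y)) ↪ Z) :=
    Function.Embedding.nonempty_of_card_le (by simpa using hm)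
  refine ⟨Function.extend e Sigma.fst fun _ => Classical.arbitrary β, fun y => ?_⟩
  rw [← Fintype.card_fin (m y), ← Finset.card_univ]
  refine Finset.card_le_card_of_injOn (fun k => e ⟨y, k⟩) (fun k _ => ?_) fun k _ l _ hkl => ?_
  · simp [e.injective.extend_apply]
  · simpa using e.injective hkl

theorem exists_map_sub_one_le_card_fiber (Z : Type*) {β : Type*} [Fintype Z] [Fintype β]
    [DecidableEq β] [Nonempty β] {f : β → ℝ} (hf : ∀ y, 0 ≤ f y) (hf1 : ∑ y, f y = 1) :
    ∃ φ : Z → β, ∀ y, Fintype.card Z * f y - 1 ≤ (#{z | φ z = y} : ℝ) := by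
  have hsum : ∑ y, ⌊Fintype.card Z * f y⌋₊ ≤ Fintype.card Z := by
    rw [← Nat.cast_le (α := ℝ), Nat.cast_sum]
    calc ∑ y, (⌊Fintype.card Z * f y⌋₊ : ℝ) ≤ ∑ y, Fintype.card Z * f y := by
          gcongr with y
          exact Nat.floor_le (mul_nonneg (Nat.cast_nonneg _) (hf y))
      _ = Fintype.card Z := by rw [← Finset.mul_sum, hf1, mul_one]
  obtain ⟨φ, hφ⟩ := exists_map_card_fiber_ge hsum
  exact ⟨φ, fun y => (Nat.sub_one_lt_floor _).le.trans (Nat.cast_le.2 (hφ y))⟩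

theorem mul_card_fiber_le_card_fiber_comp {W Z β : Type*} [Fintype W] [Fintype Z] [DecidableEq Z]
    [DecidableEq β] {σ : W → Z} {k : ℕ} (hk : ∀ z, k ≤ #{w | σ w = z}) (φ : Z → β) (y : β) :
    k * #{z | φ z = y} ≤ #{w | φ (σ w) = y} := by
  refine Finset.mul_card_image_le_card_of_maps_to (f := σ) (by simp) k fun z hz => ?_
  have hφ : φ z = y := (Finset.mem_filter.1 hz).2
  refine (hk z).trans (Finset.card_le_card fun w hw => ?_)
  simp_all

theorem prod_le_card_fiber_pi {ι U : Type*} {W G : ι → Type*} [Fintype ι] [DecidableEq ι]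
    [∀ i, Fintype (W i)] [∀ i, DecidableEq (G i)] [Fintype U] [DecidableEq U]
    {π : ∀ i, W i → G i} {k : ι → ℕ} (hk : ∀ i g, k i ≤ #{w | π i w = g}) (z : (∀ i, G i) × U) :
    ∏ i, k i ≤ #{x : (∀ i, W i) × U | ((fun i => π i (x.1 i)), x.2) = z} := by
  have hfiber : ({x : (∀ i, W i) × U | ((fun i => π i (x.1 i)), x.2) = z} : Finset _) =
      (Fintype.piFinset fun i => {w | π i w = z.1 i}) ×ˢ {z.2} := by
    ext x
    simp only [Finset.mem_filter_univ, Finset.mem_product, Fintype.mem_piFinset,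
      Finset.mem_singleton, Prod.ext_iff, funext_iff]
  rw [hfiber, Finset.card_product, Finset.card_singleton, mul_one, Fintype.card_piFinset]
  exact Finset.prod_le_prod' fun i _ => hk i (z.1 i)

end Quantization

section Differences

variable {ι G : Type*} [AddGroup G]

/-- The differences of a tuple of group elements relative to its entry at `i₀`: together with any
one of the entries they determine the tuple. -/
def differences (i₀ : ι) (g : ι → G) (j : {j // j ≠ i₀}) : G := -g i₀ + g j

theorem injective_differences_prodMk (i₀ i : ι) :
    Function.Injective fun g : ι → G => (differences i₀ g, g i) := by
  intro g g' h
  obtain ⟨hdiff, hi⟩ := Prod.mk.inj h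
  have hsub (j : ι) : -g i₀ + g j = -g' i₀ + g' j := by
    by_cases hj : j = i₀
    · rw [hj, neg_add_cancel, neg_add_cancel]
    · exact congrFun hdiff ⟨j, hj⟩
  have hbase : -g i₀ = -g' i₀ := add_right_cancel ((hsub i).trans (by rw [hi]))
  exact funext fun j => add_left_cancel ((hsub j).trans (by rw [hbase]))

theorem exists_map_prodMk_injective {U M : Type*} [Fintype ι] [Nonempty ι]
    [Fintype G] [Fintype U] [Fintype M]
    (hM : Fintype.card G ^ (Fintype.card ι - 1) * Fintype.card U ≤ Fintype.card M) :
    ∃ s : (ι → G) × U → M, ∀ i, Function.Injective fun z => (s z, z.1 i) := by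
  classical
  let i₀ := Classical.arbitrary ι
  obtain ⟨e⟩ : Nonempty (({j // j ≠ i₀} → G) × U ↪ M) :=
    Function.Embedding.nonempty_of_card_le (by simpa [Fintype.card_subtype_compl] using hM)
  refine ⟨fun z => e (differences i₀ z.1, z.2), fun i => ?_⟩
  rintro ⟨g, u⟩ ⟨g', u'⟩ h
  simp only [Prod.mk.injEq, e.injective.eq_iff] at h
  exact Prod.ext (injective_differences_prodMk i₀ i (Prod.ext h.1.1 h.2)) h.1.2

end Differences

namespace SimulationCode

section OfMaps

variable {t h : ℕ} {V : Fin t → Finset (Fin h)} {A : Fin t → Type*} {n K : ℕ} {L : Fin h → ℕ}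
  {U : Type*} [Fintype U] [Nonempty U]

/-- The simulation code with deterministic processors `dec`, in which the coordinator applies `enc`
to the sources and to private randomness that is uniform on `U`. -/
noncomputable def ofMaps (enc : (∀ j, Fin (L j)) → U → Fin K)
    (dec : ∀ i, Fin K → (∀ j : V i, Fin (L j)) → Fin n → A i) : SimulationCode V A n K L where
  coordinator w := (PMF.uniformOfFintype U).map (enc w)
  processor i m v := PMF.pure (dec i m v)

theorem induced_ofMaps [∀ i, DecidableEq (A i)] (enc : (∀ j, Fin (L j)) → U → Fin K)
    (dec : ∀ i, Fin K → (∀ j : V i, Fin (L j)) → Fin n → A i) (x : ∀ i, Fin n → A i) :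
    (ofMaps enc dec).induced x =
      (#{z : (∀ j, Fin (L j)) × U | ∀ i, dec i (enc z.1 z.2) (fun j => z.1 j) = x i} : ℝ) /
        (Fintype.card U * ∏ j, (L j : ℝ)) := by
  have hout (w : ∀ j, Fin (L j)) (u : U) :
      ∏ i, (PMF.pure (dec i (enc w u) fun j => w j) (x i)).toReal =
        if ∀ i, dec i (enc w u) (fun j => w j) = x i then 1 else 0 := by
    simp only [PMF.pure_apply, eq_comm (a := x _), apply_ite ENNReal.toReal, ENNReal.toReal_one,
      ENNReal.toReal_zero, Finset.prod_boole, Finset.mem_univ, true_imp_iff]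
  simp only [induced, ofMaps, mul_div_assoc]
  simp only [sum_toReal_pmf_map_mul, hout]
  rw [Finset.card_filter, Fintype.sum_prod_type]
  push_cast
  simp only [Finset.sum_div]
  refine Finset.sum_congr rfl fun w _ => Finset.sum_congr rfl fun u _ => ?_
  rw [PMF.uniformOfFintype_apply, ENNReal.toReal_inv, ENNReal.toReal_natCast, ← mul_div_assoc,
    inv_mul_eq_div, div_div]

end OfMaps

section Agreement

variable {t n K : ℕ} {L : Fin t → ℕ} {β U : Type*} {G : Fin t → Type*} [Fintype U] [Nonempty U]
  [∀ i, Nonempty (G i)]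

/-- The code in which the coordinator sends `s z`, where `z` consists of the values `π i (w i)` of
all the sources and of a private uniform variable, and every processor outputs `φ z`, where `z` is
determined from `s z` and the value of its own source. -/
noncomputable def agreement (π : ∀ i, Fin (L i) → G i) (s : (∀ i, G i) × U → Fin K)
    (φ : (∀ i, G i) × U → Fin n → β) :
    SimulationCode (individualAccess t) (fun _ => β) n K L :=
  ofMaps (fun w u => s ((fun i => π i (w i)), u)) fun i m v =>
    φ (Function.invFun (fun z => (s z, z.1 i)) (m, π i (v ⟨i, Finset.mem_singleton_self i⟩)))

theorem induced_agreement [NeZero t] [DecidableEq β] (π : ∀ i, Fin (L i) → G i)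
    {s : (∀ i, G i) × U → Fin K} (hs : ∀ i, Function.Injective fun z => (s z, z.1 i))
    (φ : (∀ i, G i) × U → Fin n → β) (y : Fin n → β) :
    (agreement π s φ).induced (fun _ => y) =
      (#{z : (∀ i, Fin (L i)) × U | φ ((fun i => π i (z.1 i)), z.2) = y} : ℝ) /
        (Fintype.card U * ∏ i, (L i : ℝ)) := by
  have hdec (i : Fin t) (z : (∀ i, G i) × U) :
      Function.invFun (fun z => (s z, z.1 i)) (s z, z.1 i) = z :=
    Function.leftInverse_invFun (hs i) z
  rw [agreement, induced_ofMaps]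
  simp only [fun i (w : ∀ i, Fin (L i)) u => hdec i ((fun i => π i (w i)), u), forall_const]

theorem exists_mul_sub_le_induced [NeZero t] [Fintype β] [Nonempty β] {f : (Fin n → β) → ℝ}
    (hf : ∀ y, 0 ≤ f y) (hf1 : ∑ y, f y = 1) {l N : ℕ} (hl : 0 < l) (hN : 0 < N)
    (hK : l ^ (t - 1) * N ≤ K) :
    ∃ c : SimulationCode (individualAccess t) (fun _ => β) n K L, ∀ y,
      (∏ i, usableFraction l (L i)) * (f y - 1 / (l ^ t * N)) ≤ c.induced fun _ => y := by
  classical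
  have : NeZero l := ⟨hl.ne'⟩
  have : NeZero N := ⟨hN.ne'⟩
  obtain ⟨s, hs⟩ : ∃ s : (Fin t → Fin l) × Fin N → Fin K,
      ∀ i, Function.Injective fun z => (s z, z.1 i) :=
    exists_map_prodMk_injective (by simpa using hK)
  choose π hπ using fun i => exists_map_card_fiber_ge (Z := Fin (L i)) (β := Fin l)
    (m := fun _ => L i / l) (by simpa using Nat.mul_div_le (L i) l)
  obtain ⟨φ, hφ⟩ := exists_map_sub_one_le_card_fiber ((Fin t → Fin l) × Fin N) hf hf1
  simp only [Fintype.card_prod, Fintype.card_pi, Fintype.card_fin, Finset.prod_const,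
    Finset.card_univ, Nat.cast_mul, Nat.cast_pow] at hφ
  refine ⟨agreement π s φ, fun y => ?_⟩
  have hcount : (∏ i, ((L i / l : ℕ) : ℝ)) * #{z | φ z = y} ≤
      #{z : (∀ i, Fin (L i)) × Fin N | φ ((fun i => π i (z.1 i)), z.2) = y} := by
    exact_mod_cast mul_card_fiber_le_card_fiber_comp
      (prod_le_card_fiber_pi (U := Fin N) hπ) φ y
  rw [induced_agreement π hs φ, Fintype.card_fin]
  calc (∏ i, usableFraction l (L i)) * (f y - 1 / (l ^ t * N))
      = (∏ i, ((L i / l : ℕ) : ℝ)) * ((l ^ t * N : ℝ) * f y - 1) / (N * ∏ i, (L i : ℝ)) := by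
        simp only [usableFraction, Finset.prod_div_distrib, Nat.cast_mul, Finset.prod_mul_distrib,
          Finset.prod_const, Finset.card_univ, Fintype.card_fin]
        field_simp
    _ ≤ (∏ i, ((L i / l : ℕ) : ℝ)) * #{z | φ z = y} / (N * ∏ i, (L i : ℝ)) := by
        gcongr
        exact hφ y
    _ ≤ _ := by gcongr

end Agreement

end SimulationCode

section Achievability

variable {t : ℕ} [NeZero t] {α : Type*} [Fintype α]

theorem exists_code_sum_abs_sub_iidLaw_le (p : PMF α) (n : ℕ) {K l N : ℕ} {L : Fin t → ℕ}
    (hL : ∀ i, 0 < L i) (hl : 0 < l) (hN : 0 < N) (hK : l ^ (t - 1) * N ≤ K) :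
    ∃ c : SimulationCode (individualAccess t) (fun _ => α) n K L,
      ∑ x, |c.induced x - iidLaw (A := fun _ => α) (diagonalLaw t p) n x| ≤
        2 * ((1 - ∏ i, usableFraction l (L i)) +
          ∑ y, min (blockLaw p n y) (1 / (l ^ t * N))) := by
  have : Nonempty α := ⟨p.support_nonempty.some⟩
  obtain ⟨c, hc⟩ := SimulationCode.exists_mul_sub_le_induced (L := L) (blockLaw_nonneg p n)
    (sum_blockLaw p n) hl hN hK
  refine ⟨c, (sum_abs_sub_iidLaw_diagonalLaw p c.induced_nonneg (c.sum_induced hL)).trans_le ?_⟩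
  gcongr
  exact sum_posPart_sub_le_of_mul_sub_le _ (fun y _ => blockLaw_nonneg p n y) (sum_blockLaw p n)
    (fun y _ => c.induced_nonneg _) (by positivity)
    (Finset.prod_le_one (fun i _ => usableFraction_nonneg _ _) fun i _ => usableFraction_le_one _ _)
    fun y _ => hc y

theorem indexSize_pow_mul_indexSize_le {a b R : ℝ} (m n : ℕ) (hR : m * a + b = R) :
    indexSize n a ^ m * indexSize n b ≤ indexSize n R := by
  refine Nat.le_floor ?_
  push_cast
  calc (indexSize n a : ℝ) ^ m * indexSize n b ≤ ((2 : ℝ) ^ (n * a)) ^ m * 2 ^ (n * b) := by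
        gcongr <;> exact indexSize_le _ _
    _ = 2 ^ (n * R) := by
        rw [← Real.rpow_mul_natCast two_pos.le, ← Real.rpow_add two_pos, ← hR]
        congr 1
        ring

theorem one_div_indexSize_pow_mul_indexSize_le {a b : ℝ} (ha : 0 ≤ a) (hb : 0 ≤ b) (m n : ℕ) :
    1 / ((indexSize n a : ℝ) ^ m * indexSize n b) ≤
      (2 : ℝ) ^ (m + 1) * (2 : ℝ) ^ (-(n * (m * a + b))) := by
  calc 1 / ((indexSize n a : ℝ) ^ m * indexSize n b)
      ≤ 1 / (((2 : ℝ) ^ (n * a) / 2) ^ m * (2 ^ (n * b) / 2)) := by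
        gcongr
        · exact half_le_indexSize n ha
        · exact half_le_indexSize n hb
    _ = (2 : ℝ) ^ (m + 1) * (2 : ℝ) ^ (-(n * (m * a + b))) := by
        rw [Real.rpow_neg two_pos.le, div_pow, ← Real.rpow_mul_natCast two_pos.le,
          show (n : ℝ) * (m * a + b) = n * a * m + n * b by ring, Real.rpow_add two_pos, pow_succ]
        field_simp

theorem isAchievable_of_lt {p : PMF α} {R a b : ℝ} {Rs : Fin t → ℝ} (ha : 0 ≤ a) (hb : 0 ≤ b)
    (haR : ∀ i, a < Rs i) (hR : ((t : ℝ) - 1) * a + b = R) (hH : entropyBits p < t * a + b) :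
    IsAchievable (individualAccess t) (diagonalLaw t p) R Rs := by
  have hRs (i : Fin t) : 0 ≤ Rs i := ha.trans (haR i).le
  rw [← Nat.cast_pred (NeZero.pos t)] at hR
  choose c hc using fun n => exists_code_sum_abs_sub_iidLaw_le p n
    (fun i => indexSize_pos n (hRs i)) (indexSize_pos n ha) (indexSize_pos n hb)
    (indexSize_pow_mul_indexSize_le (t - 1) n hR)
  refine ⟨by rw [← hR]; positivity, hRs, c,
    squeeze_zero (fun n => Finset.sum_nonneg fun _ _ => abs_nonneg _) hc ?_⟩
  have hfraction := tendsto_finsetProd (Finset.univ : Finset (Fin t)) fun i _ =>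
    tendsto_usableFraction_indexSize ha (haR i)
  have hspectrum := tendsto_sum_min_blockLaw_of_entropyBits_lt p hH (C := 2 ^ (t + 1))
    (by positivity) (fun n => by positivity) (one_div_indexSize_pow_mul_indexSize_le ha hb t)
  simpa using ((hfraction.const_sub 1).add hspectrum).const_mul 2

theorem isAchievable_add {p : PMF α} {R : ℝ} {Rs : Fin t → ℝ} (hRs : ∀ i, 0 ≤ Rs i)
    (hH : entropyBits p ≤ R + ⨅ i, Rs i) (hR : ((t : ℝ) - 1) * entropyBits p / t ≤ R)
    {ε : ℝ} (hε : 0 < ε) :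
    IsAchievable (individualAccess t) (diagonalLaw t p) (R + ε) fun i => Rs i + ε := by
  have ht : (1 : ℝ) ≤ t := Nat.one_le_cast.2 (NeZero.pos t)
  set a := min (⨅ i, Rs i) (entropyBits p / t)
  have ha : 0 ≤ a :=
    le_min (Real.iInf_nonneg hRs) (div_nonneg (entropyBits_nonneg p) (Nat.cast_nonneg t))
  have haRs (i : Fin t) : a ≤ Rs i :=
    (min_le_left _ _).trans (ciInf_le (Set.finite_range Rs).bddBelow i)
  have haR : ((t : ℝ) - 1) * a ≤ R := by
    refine (mul_le_mul_of_nonneg_left (min_le_right _ _) (sub_nonneg.2 ht)).trans ?_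
    rwa [← mul_div_assoc]
  have haH : entropyBits p ≤ R + a := by
    rw [← min_add_add_left]
    refine le_min hH (le_trans (le_of_eq ?_) (add_le_add_left hR _))
    field_simp
    ring
  exact isAchievable_of_lt (b := R + ε - ((t : ℝ) - 1) * a) ha (by linarith)
    (fun i => lt_add_of_le_of_pos (haRs i) hε) (by ring) (by linarith)

end Achievability

theorem continuous_iInf_apply {ι : Type*} [Finite ι] [Nonempty ι] :
    Continuous fun v : ι → ℝ => ⨅ i, v i := by
  let _ := Fintype.ofFinite ι
  simp only [← Finset.inf'_univ_eq_ciInf]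
  exact Continuous.finset_inf'_apply Finset.univ_nonempty fun i _ => continuous_apply i

theorem isClosed_rateRegion {ι : Type*} [Finite ι] [Nonempty ι] (H B : ℝ) :
    IsClosed {r : ℝ × (ι → ℝ) |
      0 ≤ r.1 ∧ (∀ i, 0 ≤ r.2 i) ∧ H ≤ r.1 + (⨅ i, r.2 i) ∧ B ≤ r.1} := by
  have hcont : Continuous fun r : ℝ × (ι → ℝ) => ⨅ i, r.2 i :=
    continuous_iInf_apply.comp continuous_snd
  simp only [Set.ofPred_and, Set.ofPred_forall]
  exact (isClosed_le continuous_const continuous_fst).inter <|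
    (isClosed_iInter fun i => isClosed_le continuous_const (by fun_prop)).inter <|
    (isClosed_le continuous_const (continuous_fst.add hcont)).inter <|
    isClosed_le continuous_const continuous_fst

/-- All outputs are equal under `q` (`hq`), and `p` is the law of the common value `X` (`hp`). -/
theorem mainTheorem8 {t : ℕ} (ht : 2 ≤ t) {α : Type*} [Fintype α]
    (q : PMF (Fin t → α)) (hq : ∀ x ∈ q.support, ∀ i j : Fin t, x i = x j)
    (p : PMF α) (hp : ∀ i : Fin t, q.map (fun x => x i) = p) :
    simulationRegion (individualAccess t) q =
      {r : ℝ × (Fin t → ℝ) | 0 ≤ r.1 ∧ (∀ i, 0 ≤ r.2 i) ∧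
        entropyBits p ≤ (r.1 + (⨅ i, r.2 i)) ∧
        ((t : ℝ) - 1) * entropyBits p / (t : ℝ) ≤ r.1} := by
  have : NeZero t := ⟨by lia⟩
  obtain rfl : q = diagonalLaw t p := hp 0 ▸ eq_diagonalLaw hq 0
  refine Set.Subset.antisymm (closure_minimal (fun r hr => ⟨hr.1, hr.2.1, ?_, ?_⟩)
    (isClosed_rateRegion _ _)) ?_
  · rw [← sub_le_iff_le_add']
    exact le_ciInf fun i => sub_le_iff_le_add'.2 (hr.entropyBits_le_add ht i)
  · exact hr.entropyBits_le_message ht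
  · rintro ⟨R, Rs⟩ ⟨-, hRs, hH, hR⟩
    have hcont : Continuous fun ε : ℝ => ((R + ε, fun i => Rs i + ε) : ℝ × (Fin t → ℝ)) := by
      fun_prop
    have hlim := (hcont.tendsto 0).mono_left (nhdsWithin_le_nhds (s := Set.Ioi 0))
    simp only [add_zero] at hlim
    exact mem_closure_of_tendsto hlim
      (eventually_nhdsWithin_of_forall fun ε hε => isAchievable_add hRs hH hR hε)
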